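/- Let $\mathcal C$ be a semi-abelian category, that is, a category with a zero object which is Barr exact (finitely complete, kernel pairs have coequalizers, regular epimorphisms are stable under pullback, and every internal equivalence relation is a kernel pair), protomodular (see below), and has finite coproducts. For an object $A$ of $\mathcal C$, let $\mathrm{Pt}_A(\mathcal C)$ be the category whose objects are the triples $(B,b,s_b)$ with $b\colon B\to A$, $s_b\colon A\to B$ and $b\,s_b=1_A$, and whose morphisms $(B,b,s_b)\to(C,c,s_c)$ are the morphisms $\varphi\colon B\to C$ of $\mathcal C$ with $c\,\varphi=b$ and $\varphi\, s_b=s_c$; it has the zero object $(A,1_A,1_A)$. For $g\colon E\to A$, let $g^*\colon \mathrm{Pt}_A(\mathcal C)\to\mathrm{Pt}_E(\mathcal C)$ be the change of base functor given by pullback along $g$, and let $K_A\colon\mathrm{Pt}_A(\mathcal C)\to\mathcal C$ be the kernel functor, which sends $(B,b,s_b)$ to $\mathrm{Ker}(b)$ and a morphism to its restriction to the kernels. Protomodularity of $\mathcal C$ means that every $K_A$ reflects isomorphisms. A monomorphism is called *normal* if it is an equivalence class of some internal equivalence relation on its codomain, and a *kernel map* is a morphism that is the kernel of some morphism. The category $\mathcal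 C$ is *strongly protomodular* if every change of base functor $g^*$ preserves finite limits, reflects isomorphisms and reflects normal monomorphisms; a *strongly semi-abelian* category is a strongly protomodular semi-abelian category. Then the following statements are equivalent: 1. $\mathcal C$ is strongly semi-abelian; 2. for every object $A$ of $\mathcal C$, the kernel functor $K_A$ satisfies condition $(\mathrm{C}^*)$: for every morphism $\varphi$ of $\mathrm{Pt}_A(\mathcal C)$ such that $K_A(\varphi)$ is a kernel map in $\mathcal C$, there exists a morphism $\gamma$ of $\mathrm{Pt}_A(\mathcal C)$, unique up to a unique isomorphism, such that $\gamma$ is a cokernel of $\varphi$ in $\mathrm{Pt}_A(\mathcal C)$ and $K_A(\gamma)$ is a cokernel of $K_A(\varphi)$ in $\mathcal C$. -/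

import Mathlib

open CategoryTheory CategoryTheory.Limits

universe v u

namespace StronglySemiAbelian

/-- An object of the fibre `Pt_A(C)` of the fibration of points over `A`: a split epimorphism
`proj : obj ⟶ A` with a chosen section `sec`. -/
structure Pt {C : Type u} [Category.{v} C] (A : C) where
  obj : C
  proj : obj ⟶ A
  sec : A ⟶ obj
  sec_proj : sec ≫ proj = 𝟙 A

attribute [simp] Pt.sec_proj

/-- A morphism of points over `A`: it commutes with the projections and with the sections. -/
@[ext]
structure PtHom {C : Type u} [Category.{v} C] {A : C} (P Q : Pt A) where
  hom : P.obj ⟶ Q.obj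
  hom_proj : hom ≫ Q.proj = P.proj
  sec_hom : P.sec ≫ hom = Q.sec

attribute [simp] PtHom.hom_proj PtHom.sec_hom

/-- The category `Pt_A(C)` of points over `A`. -/
instance Pt.category {C : Type u} [Category.{v} C] (A : C) : Category.{v} (Pt A) where
  Hom P Q := PtHom P Q
  id P := ⟨𝟙 P.obj, by simp, by simp⟩
  comp f g := ⟨f.hom ≫ g.hom, by simp, by rw [← Category.assoc, f.sec_hom, g.sec_hom]⟩
  id_comp f := PtHom.ext (Category.id_comp f.hom)
  comp_id f := PtHom.ext (Category.comp_id f.hom)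
  assoc f g h := PtHom.ext (Category.assoc f.hom g.hom h.hom)

/-- `Pt_A(C)` is pointed, with zero object `(A, 𝟙, 𝟙)`: the zero morphism from `(B, b, s_b)` to
`(D, d, s_d)` is the one that factors through `A`, namely `b` followed by `s_d`. -/
instance Pt.hasZeroMorphisms {C : Type u} [Category.{v} C] (A : C) :
    HasZeroMorphisms (Pt A) where
  zero P Q := ⟨⟨P.proj ≫ Q.sec, by simp, by rw [← Category.assoc, P.sec_proj, Category.id_comp]⟩⟩
  comp_zero {P Q} f R := PtHom.ext <|
    show f.hom ≫ (Q.proj ≫ R.sec) = P.proj ≫ R.sec by rw [← Category.assoc, f.hom_proj]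
  zero_comp P {Q R} f := PtHom.ext <|
    show (P.proj ≫ Q.sec) ≫ f.hom = P.proj ≫ R.sec by rw [Category.assoc, f.sec_hom]

/-- The morphism induced between the pullbacks along `g : E ⟶ A` by a morphism of points over `A`. -/
noncomputable def pullbackMap {C : Type u} [Category.{v} C] [HasPullbacks C] {E A : C}
    (g : E ⟶ A) {P Q : Pt A} (f : PtHom P Q) : pullback P.proj g ⟶ pullback Q.proj g :=
  pullback.lift (pullback.fst P.proj g ≫ f.hom) (pullback.snd P.proj g)
    (by rw [Category.assoc, f.hom_proj, pullback.condition])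

/-- The change of base functor `g^* : Pt_A(C) ⥤ Pt_E(C)` along `g : E ⟶ A`: pull back the split
epimorphism along `g`, with the induced section. -/
noncomputable def changeOfBase {C : Type u} [Category.{v} C] [HasPullbacks C] {E A : C}
    (g : E ⟶ A) : Pt A ⥤ Pt E where
  obj P :=
    { obj := pullback P.proj g
      proj := pullback.snd P.proj g
      sec := pullback.lift (g ≫ P.sec) (𝟙 E) (by simp)
      sec_proj := pullback.lift_snd _ _ _ }
  map {P Q} f :=
    { hom := pullbackMap g f
      hom_proj := pullback.lift_snd _ _ _
      sec_hom := by apply pullback.hom_ext <;>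
        simp [pullbackMap, pullback.lift_fst, pullback.lift_snd, pullback.lift_fst_assoc] }
  map_id P := PtHom.ext <| show pullbackMap g ⟨𝟙 P.obj, _, _⟩ = 𝟙 (pullback P.proj g) by
    apply pullback.hom_ext <;> simp [pullbackMap]
  map_comp {P Q R} f h := PtHom.ext <|
    show pullbackMap g ⟨f.hom ≫ h.hom, _, _⟩ = pullbackMap g f ≫ pullbackMap g h by
      apply pullback.hom_ext <;>
        simp [pullbackMap, pullback.lift_fst, pullback.lift_snd, pullback.lift_fst_assoc]

/-- The kernel functor `K_A : Pt_A(C) ⥤ C`, sending `(B, b, s_b)` to the kernel of `b` (the pullback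
of `b` along `0 ⟶ A`) and a morphism of points to its restriction to the kernels. -/
noncomputable def kernelFunctor {C : Type u} [Category.{v} C] [HasZeroMorphisms C] [HasKernels C]
    (A : C) : Pt A ⥤ C where
  obj P := kernel P.proj
  map {P Q} f := kernel.lift Q.proj (kernel.ι P.proj ≫ f.hom)
    (by rw [Category.assoc, f.hom_proj, kernel.condition])
  map_id P := by
    apply equalizer.hom_ext
    exact (kernel.lift_ι _ _ _).trans ((Category.comp_id _).trans (Category.id_comp _).symm)
  map_comp {P Q R} f h := by
    apply equalizer.hom_ext
    refine (kernel.lift_ι _ _ _).trans ?_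
    change kernel.ι P.proj ≫ (f.hom ≫ h.hom) = (_ ≫ _) ≫ kernel.ι R.proj
    simp

/-- `f` is a kernel map: it is the kernel of some morphism. -/
def IsKernelMap {C : Type u} [Category.{v} C] [HasZeroMorphisms C] {X Y : C} (f : X ⟶ Y) : Prop :=
  ∃ (Z : C) (g : Y ⟶ Z) (w : f ≫ g = 0), Nonempty (IsLimit (KernelFork.ofι f w))

/-- `g` is a cokernel of `f`. -/
def IsCokernelOf {C : Type u} [Category.{v} C] [HasZeroMorphisms C] {X Y Z : C}
    (g : Y ⟶ Z) (f : X ⟶ Y) : Prop :=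
  ∃ w : f ≫ g = 0, Nonempty (IsColimit (CokernelCofork.ofπ g w))

/-- `f : X ⟶ Y` is an equivalence class of the relation `(r₁, r₂)` on `Y`: any two elements of `X`
are related, i.e. `f × f` factors as `h : X × X ⟶ R` (here `P = X × X`), and an element of `Y` that
is related to an element of `X` belongs to `X`, i.e. `h` is a discrete fibration. -/
def IsClassOf {C : Type u} [Category.{v} C] {X Y R : C} (f : X ⟶ Y) (r₁ r₂ : R ⟶ Y) : Prop :=
  ∃ (P : C) (p₁ p₂ : P ⟶ X) (h : P ⟶ R),
    Nonempty (IsLimit (BinaryFan.mk p₁ p₂)) ∧ IsPullback h p₁ r₁ f ∧ IsPullback h p₂ r₂ f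

/-- Normal monomorphisms in the sense of Bourn: monomorphisms that are an equivalence class of
some internal equivalence relation on their codomain. (Mathlib's `NormalMono` is instead the
notion of kernel map.) -/
def IsNormalMono {C : Type u} [Category.{v} C] {X Y : C} (f : X ⟶ Y) : Prop :=
  Mono f ∧ ∃ (R : C) (r₁ r₂ : R ⟶ Y), IsEquivalenceRelation r₁ r₂ ∧ IsClassOf f r₁ r₂

/-- Normal functors: left exact, conservative, and reflecting normal monomorphisms. -/
structure IsNormalFunctor {C : Type*} [Category* C] {D : Type*} [Category* D] (F : C ⥤ D) :
    Prop where
  leftExact : PreservesFiniteLimits F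
  conservative : F.ReflectsIsomorphisms
  reflects_normalMono : ∀ {X Y : C} (f : X ⟶ Y), IsNormalMono (F.map f) → IsNormalMono f

/-- Semi-abelian categories: pointed, protomodular (every kernel functor reflects isomorphisms),
Barr exact (regular, and every equivalence relation is a kernel pair), with finite coproducts. -/
class SemiAbelian (C : Type u) [Category.{v} C] [HasZeroMorphisms C] : Prop
    extends Regular C where
  hasZeroObject : HasZeroObject C
  protomodular : ∀ A : C, (kernelFunctor A).ReflectsIsomorphisms
  effective : ∀ {R X : C} (r₁ r₂ : R ⟶ X), IsEquivalenceRelation r₁ r₂ →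
    ∃ (Y : C) (q : X ⟶ Y), IsKernelPair q r₁ r₂
  hasFiniteCoproducts : HasFiniteCoproducts C

/-- Strong protomodularity: every change of base functor of the fibration of points is normal. -/
def StronglyProtomodular (C : Type u) [Category.{v} C] [HasPullbacks C] : Prop :=
  ∀ {E A : C} (g : E ⟶ A), IsNormalFunctor (changeOfBase g)

/-- Strongly semi-abelian categories: semi-abelian and strongly protomodular. -/
structure IsStronglySemiAbelian (C : Type u) [Category.{v} C] [HasZeroMorphisms C] : Prop
    extends SemiAbelian C where
  stronglyProtomodular : StronglyProtomodular C

/-- Condition `(C*)` for `A`: every `φ` in `Pt_A(C)` such that `K_A(φ)` is a kernel map has a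
cokernel `γ` in `Pt_A(C)` such that `K_A(γ)` is a cokernel of `K_A(φ)`; and this `γ` is unique (as
a cokernel is: up to a unique isomorphism). -/
def ConditionCStar {C : Type u} [Category.{v} C] [HasZeroMorphisms C] [HasKernels C] (A : C) :
    Prop :=
  ∀ {P Q : Pt A} (φ : P ⟶ Q), IsKernelMap ((kernelFunctor A).map φ) →
    ∃ (D : Pt A) (γ : Q ⟶ D),
      (IsCokernelOf γ φ ∧ IsCokernelOf ((kernelFunctor A).map γ) ((kernelFunctor A).map φ)) ∧
      ∀ (D' : Pt A) (γ' : Q ⟶ D'),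
        (IsCokernelOf γ' φ ∧ IsCokernelOf ((kernelFunctor A).map γ') ((kernelFunctor A).map φ)) →
          ∃! e : D ≅ D', γ ≫ e.hom = γ'

end StronglySemiAbelian

/-! The link between the two conditions is that change of base does not alter kernels: `K_E ∘ g^*`
agrees with `K_A` up to isomorphism. With protomodularity this makes every `g^*` conservative, and
`g^*` is always left exact, so only the reflection of normal monomorphisms is at stake. The
uniqueness clause of `(C*)` is automatic for cokernels.

From strong protomodularity to `(C*)`: pull `φ` back along `0 ⟶ A`. Over a zero object a point is
just its kernel, so the pullback of `φ` is a kernel map as soon as `K_A(φ)` is one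
(`isKernelMap_of_kernelFunctor_map`), hence normal; by reflection `φ` is normal. Quotienting by the
equivalence relation of which `φ` is a class gives the required cokernel
(`IsNormalMono.exists_cokernel`).

Conversely, if `g^*(f)` is normal, then its restriction to kernels, and so also `K_A(f)`, is a
kernel map. `(C*)` provides `γ`, and protomodularity identifies `f` with the kernel of `γ`
(`isKernelMap_of_isCokernelOf_map`), so `f` is normal. -/

namespace StronglySemiAbelian

/-! ### Kernel maps, cokernels and normal monomorphisms -/

section ZeroMorphisms

variable {D : Type*} [Category* D] [HasZeroMorphisms D]

lemma exists_lift_of_isLimit {X Y Z T : D} {f : X ⟶ Y} {g : Y ⟶ Z} {w : f ≫ g = 0}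
    (h : Nonempty (IsLimit (KernelFork.ofι f w))) (t : T ⟶ Y) (ht : t ≫ g = 0) :
    ∃ l : T ⟶ X, l ≫ f = t :=
  ⟨_, (KernelFork.IsLimit.lift' h.some t ht).2⟩

lemma IsKernelMap.mono {X Y : D} {f : X ⟶ Y} (h : IsKernelMap f) : Mono f := by
  obtain ⟨Z, g, w, ⟨hl⟩⟩ := h
  exact mono_of_isLimit_fork hl

lemma IsKernelMap.mk {X Y Z : D} {f : X ⟶ Y} [Mono f] (g : Y ⟶ Z) (w : f ≫ g = 0)
    (hl : ∀ ⦃T : D⦄ (t : T ⟶ Y), t ≫ g = 0 → ∃ l : T ⟶ X, l ≫ f = t) : IsKernelMap f := by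
  choose! l hl using hl
  exact ⟨Z, g, w, ⟨KernelFork.IsLimit.ofι' f w fun {T} t ht => ⟨l t, hl t ht⟩⟩⟩

lemma isKernelMap_kernel_ι {Y Z : D} (g : Y ⟶ Z) [HasKernel g] : IsKernelMap (kernel.ι g) :=
  .mk g (kernel.condition g) fun _ t ht => ⟨kernel.lift g t ht, kernel.lift_ι g t ht⟩

lemma IsKernelMap.of_iso {X Y X' Y' : D} {f : X ⟶ Y} {f' : X' ⟶ Y'} (h : IsKernelMap f)
    (i : X ≅ X') (j : Y ≅ Y') (w : f ≫ j.hom = i.hom ≫ f') : IsKernelMap f' := by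
  have hf := h.mono
  obtain ⟨Z, g, hg, hl⟩ := h
  have e : f' = i.inv ≫ f ≫ j.hom := by rw [w, Iso.inv_hom_id_assoc]
  have : Mono f' := by rw [e]; infer_instance
  refine .mk (j.inv ≫ g) (by simp [e, hg]) fun T t ht => ?_
  obtain ⟨l, hl⟩ := exists_lift_of_isLimit hl (t ≫ j.inv) (by simpa using ht)
  exact ⟨l ≫ i.hom, by rw [Category.assoc, ← w, ← Category.assoc, hl]; simp⟩

lemma IsCokernelOf.epi {X Y Z : D} {g : Y ⟶ Z} {f : X ⟶ Y} (h : IsCokernelOf g f) : Epi g := by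
  obtain ⟨w, ⟨hl⟩⟩ := h
  exact epi_of_isColimit_cofork hl

lemma IsCokernelOf.exists_desc {X Y Z T : D} {g : Y ⟶ Z} {f : X ⟶ Y} (h : IsCokernelOf g f)
    (t : Y ⟶ T) (ht : f ≫ t = 0) : ∃ l : Z ⟶ T, g ≫ l = t := by
  obtain ⟨w, ⟨hl⟩⟩ := h
  exact ⟨_, (CokernelCofork.IsColimit.desc' hl t ht).2⟩

lemma IsCokernelOf.mk {X Y Z : D} {g : Y ⟶ Z} {f : X ⟶ Y} [Epi g] (w : f ≫ g = 0)
    (hd : ∀ ⦃T : D⦄ (t : Y ⟶ T), f ≫ t = 0 → ∃ l : Z ⟶ T, g ≫ l = t) : IsCokernelOf g f := by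
  choose! d hd using hd
  exact ⟨w, ⟨CokernelCofork.IsColimit.ofπ' g w fun {T} t ht => ⟨d t, hd t ht⟩⟩⟩

/-- Two cokernels of the same morphism are related by a unique isomorphism. -/
lemma IsCokernelOf.existsUnique_iso {X Y Z Z' : D} {f : X ⟶ Y} {g : Y ⟶ Z} {g' : Y ⟶ Z'}
    (h : IsCokernelOf g f) (h' : IsCokernelOf g' f) : ∃! e : Z ≅ Z', g ≫ e.hom = g' := by
  have := h.epi
  have := h'.epi
  obtain ⟨l, hl⟩ := h.exists_desc g' h'.1
  obtain ⟨l', hl'⟩ := h'.exists_desc g h.1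
  refine ⟨⟨l, l', ?_, ?_⟩, hl, fun e he => ?_⟩
  · rw [← cancel_epi g, ← Category.assoc, hl, hl', Category.comp_id]
  · rw [← cancel_epi g', ← Category.assoc, hl', hl, Category.comp_id]
  · ext
    rw [← cancel_epi g, he, hl]

/-- A kernel map is a kernel of each of its cokernels. -/
lemma IsKernelMap.exists_lift_of_isCokernelOf {X Y Z T : D} {f : X ⟶ Y} {g : Y ⟶ Z}
    (h : IsKernelMap f) (hg : IsCokernelOf g f) (t : T ⟶ Y) (ht : t ≫ g = 0) :
    ∃ l : T ⟶ X, l ≫ f = t := by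
  obtain ⟨W, m, hm, hl⟩ := h
  obtain ⟨d, hd⟩ := hg.exists_desc m hm
  exact exists_lift_of_isLimit hl t (by rw [← hd, ← Category.assoc, ht, zero_comp])

/-- A kernel of `g` is the class of zero for the kernel pair of `g`. -/
lemma IsKernelMap.isNormalMono [HasPullbacks D] [HasBinaryProducts D] {X Y : D} {f : X ⟶ Y}
    (h : IsKernelMap f) : IsNormalMono f := by
  have hf := h.mono
  obtain ⟨Z, g, hg, hl⟩ := h
  have hw : (prod.fst : X ⨯ X ⟶ X) ≫ f ≫ g = prod.snd ≫ f ≫ g := by simp [hg]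
  refine ⟨hf, pullback g g, pullback.fst g g, pullback.snd g g,
    (IsKernelPair.equivalenceRelation g _ _
      (pullbackIsPullback (pullback.snd g g) (pullback.fst g g))
      (IsKernelPair.of_hasPullback g)).isEquivalenceRelation,
    X ⨯ X, prod.fst, prod.snd,
    pullback.lift (prod.fst ≫ f) (prod.snd ≫ f) (by simpa using hw),
    ⟨prodIsProd X X⟩, ?_, ?_⟩
  · refine IsPullback.mk' (by simp [pullback.lift_fst]) (fun T a b h₁ h₂ => ?_) fun T a b hab => ?_
    · have h₃ := congr($h₁ ≫ pullback.snd g g)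
      simp only [Category.assoc, pullback.lift_snd] at h₃
      simp only [← Category.assoc, cancel_mono] at h₃
      exact prod.hom_ext h₂ h₃
    -- A pair in the kernel pair of `g` whose first entry lies in `X` has both entries killed by
    -- `g`, so the second entry lies in `X` too.
    · obtain ⟨c, hc⟩ := exists_lift_of_isLimit hl (a ≫ pullback.snd g g) (by
        rw [Category.assoc, ← pullback.condition, ← Category.assoc, hab, Category.assoc, hg,
          comp_zero])
      exact ⟨prod.lift b c, by
        apply pullback.hom_ext <;>
          simp [hab, hc, pullback.lift_fst, pullback.lift_snd, prod.lift_fst_assoc,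
            prod.lift_snd_assoc], prod.lift_fst _ _⟩
  · refine IsPullback.mk' (by simp [pullback.lift_snd]) (fun T a b h₁ h₂ => ?_) fun T a b hab => ?_
    · have h₃ := congr($h₁ ≫ pullback.fst g g)
      simp only [Category.assoc, pullback.lift_fst] at h₃
      simp only [← Category.assoc, cancel_mono] at h₃
      exact prod.hom_ext h₃ h₂
    · obtain ⟨c, hc⟩ := exists_lift_of_isLimit hl (a ≫ pullback.fst g g) (by
        rw [Category.assoc, pullback.condition, ← Category.assoc, hab, Category.assoc, hg,
          comp_zero])
      exact ⟨prod.lift c b, by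
        apply pullback.hom_ext <;>
          simp [hab, hc, pullback.lift_fst, pullback.lift_snd, prod.lift_fst_assoc,
            prod.lift_snd_assoc], prod.lift_snd _ _⟩

end ZeroMorphisms

/-! ### Limits and equivalence relations in the category of points -/

section Points

variable {C : Type u} [Category.{v} C] {A : C}

@[ext]
lemma Pt.hom_ext {P Q : Pt A} {f g : P ⟶ Q} (h : f.hom = g.hom) : f = g := PtHom.ext h

@[simp]
lemma Pt.id_hom (P : Pt A) : (𝟙 P : P ⟶ P).hom = 𝟙 P.obj := rfl

@[simp]
lemma Pt.comp_hom {P Q R : Pt A} (f : P ⟶ Q) (g : Q ⟶ R) : (f ≫ g).hom = f.hom ≫ g.hom := rfl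

@[simp]
lemma Pt.zero_hom (P Q : Pt A) : (0 : P ⟶ Q).hom = P.proj ≫ Q.sec := rfl

lemma Pt.hom_proj {P Q : Pt A} (f : P ⟶ Q) : f.hom ≫ Q.proj = P.proj := f.hom_proj

lemma Pt.sec_hom {P Q : Pt A} (f : P ⟶ Q) : P.sec ≫ f.hom = Q.sec := f.sec_hom

lemma Pt.isIso_hom {P Q : Pt A} (f : P ⟶ Q) [IsIso f] : IsIso f.hom :=
  ⟨(inv f).hom, by rw [← Pt.comp_hom, IsIso.hom_inv_id, Pt.id_hom],
    by rw [← Pt.comp_hom, IsIso.inv_hom_id, Pt.id_hom]⟩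

/-- The forgetful functor from points to the ambient category reflects pullback squares. -/
lemma Pt.isPullback_of_hom {P X Y Z : Pt A} {p : P ⟶ X} {q : P ⟶ Y} {f : X ⟶ Z} {g : Y ⟶ Z}
    (h : IsPullback p.hom q.hom f.hom g.hom) : IsPullback p q f g := by
  refine IsPullback.mk' (Pt.hom_ext h.w) (fun T a b h₁ h₂ => ?_) fun T a b hab => ?_
  · exact Pt.hom_ext (h.hom_ext congr(($h₁).hom) congr(($h₂).hom))
  · have hab' : a.hom ≫ f.hom = b.hom ≫ g.hom := congr(($hab).hom)
    refine ⟨⟨h.lift a.hom b.hom hab', ?_, ?_⟩, Pt.hom_ext (h.lift_fst _ _ _),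
      Pt.hom_ext (h.lift_snd _ _ _)⟩
    · rw [← Pt.hom_proj p, ← Category.assoc, h.lift_fst, Pt.hom_proj]
    · apply h.hom_ext
      · rw [Category.assoc, h.lift_fst, Pt.sec_hom, Pt.sec_hom]
      · rw [Category.assoc, h.lift_snd, Pt.sec_hom, Pt.sec_hom]

/-- The pullback of points, computed in the ambient category. -/
noncomputable def Pt.pullbackPt [HasPullbacks C] {X Y Z : Pt A} (f : X ⟶ Z) (g : Y ⟶ Z) :
    Pt A where
  obj := pullback f.hom g.hom
  proj := pullback.fst f.hom g.hom ≫ X.proj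
  sec := pullback.lift X.sec Y.sec (by rw [Pt.sec_hom, Pt.sec_hom])
  sec_proj := by rw [pullback.lift_fst_assoc, X.sec_proj]

instance Pt.hasPullbacks [HasPullbacks C] : HasPullbacks (Pt A) := by
  refine @hasPullbacks_of_hasLimit_cospan _ _ fun {X Y Z f g} => ?_
  have w : pullback.snd f.hom g.hom ≫ Y.proj = pullback.fst f.hom g.hom ≫ X.proj := by
    rw [← Pt.hom_proj f, ← Pt.hom_proj g, ← Category.assoc, ← pullback.condition, Category.assoc]
  let p : Pt.pullbackPt f g ⟶ X := ⟨pullback.fst f.hom g.hom, rfl, pullback.lift_fst _ _ _⟩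
  let q : Pt.pullbackPt f g ⟶ Y := ⟨pullback.snd f.hom g.hom, w, pullback.lift_snd _ _ _⟩
  have : IsPullback p q f g := Pt.isPullback_of_hom (IsPullback.of_hasPullback f.hom g.hom)
  exact this.hasPullback

instance Pt.hasZeroObject : HasZeroObject (Pt A) :=
  ⟨⟨A, 𝟙 A, 𝟙 A, Category.comp_id _⟩,
    (IsZero.iff_id_eq_zero _).2 (Pt.hom_ext (Category.comp_id _).symm)⟩

instance Pt.hasBinaryProducts [HasPullbacks C] : HasBinaryProducts (Pt A) :=
  hasBinaryProducts_of_hasTerminal_and_pullbacks _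

instance Pt.hasFiniteLimits [HasPullbacks C] : HasFiniteLimits (Pt A) :=
  hasFiniteLimits_of_hasTerminal_and_pullbacks

/-- The free point on an object over `A`. -/
lemma Pt.exists_free [HasBinaryCoproducts C] {T : C} (t : T ⟶ A) :
    ∃ (F : Pt A) (i : T ⟶ F.obj), ∀ ⦃P : Pt A⦄,
      (∀ u : T ⟶ P.obj, u ≫ P.proj = t → ∃ h : F ⟶ P, i ≫ h.hom = u) ∧
      ∀ h h' : F ⟶ P, i ≫ h.hom = i ≫ h'.hom → h = h' := by
  refine ⟨⟨T ⨿ A, coprod.desc t (𝟙 A), coprod.inr, coprod.inr_desc _ _⟩, coprod.inl,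
    fun P => ⟨fun u hu => ⟨⟨coprod.desc u P.sec, ?_, coprod.inr_desc _ _⟩, coprod.inl_desc _ _⟩,
      fun h h' e => Pt.hom_ext (coprod.hom_ext e ?_)⟩⟩
  · apply coprod.hom_ext <;> simp [hu]
  · exact (Pt.sec_hom h).trans (Pt.sec_hom h').symm

/-- Morphisms `T ⟶ R.obj` over `A` are the morphisms of points out of the free point on `T`, so
cancellation can be tested in `Pt A`. -/
lemma Pt.jointlyMono_hom [HasBinaryCoproducts C] {R X Y : Pt A} {p : R ⟶ X} {q : R ⟶ Y}
    (h : ∀ ⦃T : Pt A⦄ (a b : T ⟶ R), a ≫ p = b ≫ p → a ≫ q = b ≫ q → a = b)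
    {T : C} {a b : T ⟶ R.obj} (hp : a ≫ p.hom = b ≫ p.hom) (hq : a ≫ q.hom = b ≫ q.hom) :
    a = b := by
  have hab : b ≫ R.proj = a ≫ R.proj := by
    rw [← Pt.hom_proj p, ← Category.assoc, ← hp, Category.assoc]
  obtain ⟨F, i, hF⟩ := Pt.exists_free (a ≫ R.proj)
  obtain ⟨a', ha⟩ := (hF (P := R)).1 a rfl
  obtain ⟨b', hb⟩ := (hF (P := R)).1 b hab
  have : a' = b' := by
    apply h
    · apply (hF (P := _)).2
      rw [Pt.comp_hom, Pt.comp_hom, ← Category.assoc, ← Category.assoc, ha, hb, hp]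
    · apply (hF (P := _)).2
      rw [Pt.comp_hom, Pt.comp_hom, ← Category.assoc, ← Category.assoc, ha, hb, hq]
  rw [← ha, ← hb, this]

lemma Pt.mono_hom [HasBinaryCoproducts C] {P Q : Pt A} (f : P ⟶ Q) [Mono f] : Mono f.hom :=
  ⟨fun _ _ h => Pt.jointlyMono_hom (p := f) (q := f)
    (fun _ _ _ e _ => (cancel_mono f).1 e) h h⟩

/-- The forgetful functor from points to the ambient category preserves pullback squares. -/
lemma Pt.isPullback_hom [HasBinaryCoproducts C] {P X Y Z : Pt A} {p : P ⟶ X} {q : P ⟶ Y}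
    {f : X ⟶ Z} {g : Y ⟶ Z} (h : IsPullback p q f g) :
    IsPullback p.hom q.hom f.hom g.hom := by
  refine IsPullback.mk' congr(($h.w).hom)
    (fun T a b => Pt.jointlyMono_hom fun _ _ _ => h.hom_ext) fun T a b hab => ?_
  have hb : b ≫ Y.proj = a ≫ X.proj := by
    rw [← Pt.hom_proj f, ← Pt.hom_proj g, ← Category.assoc, ← hab, Category.assoc]
  obtain ⟨F, i, hF⟩ := Pt.exists_free (a ≫ X.proj)
  obtain ⟨a', ha'⟩ := (hF (P := X)).1 a rfl
  obtain ⟨b', hb'⟩ := (hF (P := Y)).1 b hb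
  have w : a' ≫ f = b' ≫ g := by
    apply (hF (P := _)).2
    rw [Pt.comp_hom, Pt.comp_hom, ← Category.assoc, ← Category.assoc, ha', hb', hab]
  refine ⟨i ≫ (h.lift a' b' w).hom, ?_, ?_⟩
  · rw [Category.assoc, ← Pt.comp_hom, h.lift_fst, ha']
  · rw [Category.assoc, ← Pt.comp_hom, h.lift_snd, hb']

/-- Effectiveness is assumed only in `C`, so relations on points have to be carried there before
being quotiented. -/
lemma Pt.isEquivalenceRelation_hom [HasBinaryCoproducts C] {R X : Pt A} {p q : R ⟶ X}
    (h : IsEquivalenceRelation p q) : IsEquivalenceRelation p.hom q.hom := by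
  obtain ⟨⟨e⟩⟩ := h
  have hc := Pt.isPullback_hom (IsPullback.of_isLimit e.isLimit)
  exact ⟨⟨{
    right_cancellation := fun T a b => Pt.jointlyMono_hom e.right_cancellation
    r := e.r.hom
    reflexivity₁ := congr(($e.reflexivity₁).hom)
    reflexivity₂ := congr(($e.reflexivity₂).hom)
    s := e.s.hom
    symmetry₁ := congr(($e.symmetry₁).hom)
    symmetry₂ := congr(($e.symmetry₂).hom)
    c := hc.cone
    isLimit := hc.isLimit
    t := e.t.hom
    transitivity₁ := congr(($e.transitivity₁).hom)
    transitivity₂ := congr(($e.transitivity₂).hom) }⟩⟩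

end Points

/-! ### Left exactness of change of base -/

section ChangeOfBase

variable {C : Type u} [Category.{v} C] [HasPullbacks C] {E A : C} (g : E ⟶ A)

/-- The projection from the change of base of a point to the point itself. -/
noncomputable def changeOfBaseFst (P : Pt A) : ((changeOfBase g).obj P).obj ⟶ P.obj :=
  pullback.fst P.proj g

lemma isPullback_changeOfBase (P : Pt A) :
    IsPullback (changeOfBaseFst g P) ((changeOfBase g).obj P).proj P.proj g :=
  IsPullback.of_hasPullback P.proj g

lemma changeOfBase_map_fst {P Q : Pt A} (f : P ⟶ Q) :
    ((changeOfBase g).map f).hom ≫ changeOfBaseFst g Q = changeOfBaseFst g P ≫ f.hom :=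
  pullback.lift_fst _ _ _

lemma changeOfBase_sec_fst (P : Pt A) :
    ((changeOfBase g).obj P).sec ≫ changeOfBaseFst g P = g ≫ P.sec :=
  pullback.lift_fst _ _ _

instance changeOfBase_preservesZeroMorphisms :
    (changeOfBase g).PreservesZeroMorphisms where
  map_zero P Q := Pt.hom_ext <| by
    apply (isPullback_changeOfBase g Q).hom_ext
    · rw [changeOfBase_map_fst, Pt.zero_hom, Pt.zero_hom, Category.assoc, changeOfBase_sec_fst,
        ← Category.assoc, ← Category.assoc, (isPullback_changeOfBase g P).w]
    · rw [Pt.hom_proj, Pt.hom_proj]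

/-- Pullbacks of points are computed in `C`, where pulling back along `g` commutes with them. -/
lemma changeOfBase_map_isPullback [HasBinaryCoproducts C] {P X Y Z : Pt A} {p : P ⟶ X} {q : P ⟶ Y}
    {f : X ⟶ Z} {k : Y ⟶ Z} (h : IsPullback p q f k) :
    IsPullback ((changeOfBase g).map p) ((changeOfBase g).map q) ((changeOfBase g).map f)
      ((changeOfBase g).map k) := by
  have hC := Pt.isPullback_hom h
  apply Pt.isPullback_of_hom
  refine IsPullback.mk' ?_ (fun T a b h₁ h₂ => ?_) fun T a b hab => ?_
  · rw [← Pt.comp_hom, ← Pt.comp_hom, ← Functor.map_comp, ← Functor.map_comp, h.w]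
  · apply (isPullback_changeOfBase g P).hom_ext
    · apply hC.hom_ext
      · rw [Category.assoc, Category.assoc, ← changeOfBase_map_fst, ← Category.assoc, h₁,
          Category.assoc]
      · rw [Category.assoc, Category.assoc, ← changeOfBase_map_fst, ← Category.assoc, h₂,
          Category.assoc]
    · rw [← Pt.hom_proj ((changeOfBase g).map p), ← Category.assoc, h₁, Category.assoc]
  · have w₁ : (a ≫ changeOfBaseFst g X) ≫ f.hom = (b ≫ changeOfBaseFst g Y) ≫ k.hom := by
      rw [Category.assoc, Category.assoc, ← changeOfBase_map_fst, ← changeOfBase_map_fst,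
        ← Category.assoc, hab, Category.assoc]
    have w₂ : b ≫ ((changeOfBase g).obj Y).proj = a ≫ ((changeOfBase g).obj X).proj := by
      rw [← Pt.hom_proj ((changeOfBase g).map k), ← Category.assoc, ← hab, Category.assoc,
        Pt.hom_proj]
    refine ⟨(isPullback_changeOfBase g P).lift (hC.lift _ _ w₁)
      (a ≫ ((changeOfBase g).obj X).proj) ?_, ?_, ?_⟩
    · rw [← Pt.hom_proj p, ← Category.assoc, hC.lift_fst, Category.assoc, Category.assoc,
        (isPullback_changeOfBase g X).w]
    · apply (isPullback_changeOfBase g X).hom_ext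
      · rw [Category.assoc, changeOfBase_map_fst, ← Category.assoc, IsPullback.lift_fst,
          hC.lift_fst]
      · rw [Category.assoc, Pt.hom_proj ((changeOfBase g).map p), IsPullback.lift_snd]
    · apply (isPullback_changeOfBase g Y).hom_ext
      · rw [Category.assoc, changeOfBase_map_fst, ← Category.assoc, IsPullback.lift_fst,
          hC.lift_snd]
      · rw [Category.assoc, Pt.hom_proj ((changeOfBase g).map q), IsPullback.lift_snd, w₂]

lemma changeOfBase_preservesFiniteLimits [HasBinaryCoproducts C] :
    PreservesFiniteLimits (changeOfBase g) := by
  have := Functor.preservesTerminalObject_of_preservesZeroMorphisms (changeOfBase g)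
  have : PreservesLimitsOfShape (Discrete PEmpty.{1}) (changeOfBase g) :=
    preservesLimitsOfShape_pempty_of_preservesTerminal _
  have : PreservesLimitsOfShape WalkingCospan (changeOfBase g) := by
    apply preservesLimitsOfShape_walkingCospan_of_forall_isPullback
    intro X Y Z f k _
    exact ⟨_, _, _, IsPullback.of_hasPullback f k,
      changeOfBase_map_isPullback g (IsPullback.of_hasPullback f k)⟩
  exact preservesFiniteLimits_of_preservesTerminal_and_pullbacks _

end ChangeOfBase

/-! ### The kernel functor and its invariance under change of base -/

section Kernels

variable {C : Type u} [Category.{v} C] [HasZeroMorphisms C] [HasKernels C] {A : C}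

/-- The inclusion of the kernel of a point. -/
noncomputable def kernelFunctorι (P : Pt A) : (kernelFunctor A).obj P ⟶ P.obj :=
  kernel.ι P.proj

instance (P : Pt A) : Mono (kernelFunctorι P) :=
  inferInstanceAs (Mono (kernel.ι P.proj))

lemma kernelFunctorι_proj (P : Pt A) : kernelFunctorι P ≫ P.proj = 0 := kernel.condition P.proj

lemma exists_lift_kernelFunctorι (P : Pt A) {T : C} (t : T ⟶ P.obj) (ht : t ≫ P.proj = 0) :
    ∃ l, l ≫ kernelFunctorι P = t :=
  ⟨kernel.lift P.proj t ht, kernel.lift_ι _ _ _⟩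

lemma kernelFunctor_map_ι {P Q : Pt A} (f : P ⟶ Q) :
    (kernelFunctor A).map f ≫ kernelFunctorι Q = kernelFunctorι P ≫ f.hom :=
  kernel.lift_ι _ _ _

lemma kernelFunctor_mono_map {P Q : Pt A} (f : P ⟶ Q) [Mono f.hom] :
    Mono ((kernelFunctor A).map f) :=
  have : Mono ((kernelFunctor A).map f ≫ kernelFunctorι Q) := by
    rw [kernelFunctor_map_ι]; infer_instance
  mono_of_mono _ (kernelFunctorι Q)

lemma kernelFunctor_map_eq_zero {P Q : Pt A} (f : P ⟶ Q) (h : f = 0) :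
    (kernelFunctor A).map f = 0 := by
  rw [← cancel_mono (kernelFunctorι Q), kernelFunctor_map_ι, h, Pt.zero_hom, ← Category.assoc,
    kernelFunctorι_proj, zero_comp, zero_comp]

/-- Restricting a morphism of points to the kernels amounts to pulling it back. -/
lemma isPullback_kernelFunctor_map {P Q : Pt A} (f : P ⟶ Q) :
    IsPullback ((kernelFunctor A).map f) (kernelFunctorι P) (kernelFunctorι Q) f.hom := by
  refine IsPullback.mk' (kernelFunctor_map_ι f) (fun T a b _ h => (cancel_mono _).1 h)
    fun T a b hab => ?_
  obtain ⟨l, hl⟩ := exists_lift_kernelFunctorι P b (by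
    rw [← Pt.hom_proj f, ← Category.assoc, ← hab, Category.assoc, kernelFunctorι_proj, comp_zero])
  exact ⟨l, by
    rw [← cancel_mono (kernelFunctorι Q), Category.assoc, kernelFunctor_map_ι, ← Category.assoc,
      hl, hab], hl⟩

variable [HasPullbacks C]

/-- Change of base does not alter the kernel of a point. -/
lemma exists_iso_kernelFunctor_obj_changeOfBase {E A : C} (g : E ⟶ A) (P : Pt A) :
    ∃ i : (kernelFunctor E).obj ((changeOfBase g).obj P) ≅ (kernelFunctor A).obj P,
      i.hom ≫ kernelFunctorι P = kernelFunctorι _ ≫ changeOfBaseFst g P := by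
  have hP := isPullback_changeOfBase g P
  obtain ⟨a, ha⟩ := exists_lift_kernelFunctorι P (kernelFunctorι _ ≫ changeOfBaseFst g P) (by
    rw [Category.assoc, hP.w, ← Category.assoc, kernelFunctorι_proj, zero_comp])
  obtain ⟨b, hb⟩ := exists_lift_kernelFunctorι ((changeOfBase g).obj P)
    (hP.lift (kernelFunctorι P) 0 (by rw [kernelFunctorι_proj, zero_comp])) (hP.lift_snd _ _ _)
  refine ⟨⟨a, b, ?_, ?_⟩, ha⟩
  · rw [← cancel_mono (kernelFunctorι _), Category.assoc, hb, Category.id_comp]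
    apply hP.hom_ext
    · rw [Category.assoc, hP.lift_fst, ha]
    · rw [Category.assoc, hP.lift_snd, comp_zero, kernelFunctorι_proj]
  · rw [← cancel_mono (kernelFunctorι _), Category.assoc, ha, ← Category.assoc, hb, hP.lift_fst,
      Category.id_comp]

lemma exists_iso_kernelFunctor_changeOfBase {E A : C} (g : E ⟶ A) {P Q : Pt A} (f : P ⟶ Q) :
    ∃ (i : (kernelFunctor E).obj ((changeOfBase g).obj P) ≅ (kernelFunctor A).obj P)
      (j : (kernelFunctor E).obj ((changeOfBase g).obj Q) ≅ (kernelFunctor A).obj Q),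
      (kernelFunctor E).map ((changeOfBase g).map f) ≫ j.hom =
        i.hom ≫ (kernelFunctor A).map f := by
  obtain ⟨i, hi⟩ := exists_iso_kernelFunctor_obj_changeOfBase g P
  obtain ⟨j, hj⟩ := exists_iso_kernelFunctor_obj_changeOfBase g Q
  refine ⟨i, j, ?_⟩
  rw [← cancel_mono (kernelFunctorι Q), Category.assoc, Category.assoc, hj, kernelFunctor_map_ι,
    ← Category.assoc, kernelFunctor_map_ι, Category.assoc, changeOfBase_map_fst,
    ← Category.assoc, ← hi, Category.assoc]

lemma isKernelMap_kernelFunctor_changeOfBase_iff {E A : C} (g : E ⟶ A) {P Q : Pt A} (f : P ⟶ Q) :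
    IsKernelMap ((kernelFunctor E).map ((changeOfBase g).map f)) ↔
      IsKernelMap ((kernelFunctor A).map f) := by
  obtain ⟨i, j, h⟩ := exists_iso_kernelFunctor_changeOfBase g f
  refine ⟨fun hf => hf.of_iso i j h, fun hf => hf.of_iso i.symm j.symm ?_⟩
  rw [Iso.symm_hom, Iso.symm_hom, Iso.comp_inv_eq, Category.assoc, h, Iso.inv_hom_id_assoc]

end Kernels

/-! ### Points over a zero object -/

section OverZero

variable {C : Type u} [Category.{v} C] [HasZeroMorphisms C] [HasKernels C]

/-- Over a zero object, the kernel functor reflects kernel maps. -/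
lemma isKernelMap_of_kernelFunctor_map {E : C} (hE : IsZero E) {P Q : Pt E} (f : P ⟶ Q)
    (h : IsKernelMap ((kernelFunctor E).map f)) : IsKernelMap f := by
  have hm := h.mono
  obtain ⟨Z, m, hfm, hl⟩ := h
  -- As `E` is zero, the identities factor through the kernels: `p` and `q` are inverse to the
  -- kernel inclusions.
  obtain ⟨p, hp⟩ := exists_lift_kernelFunctorι P (𝟙 P.obj) (hE.eq_of_tgt _ _)
  obtain ⟨q, hq⟩ := exists_lift_kernelFunctorι Q (𝟙 Q.obj) (hE.eq_of_tgt _ _)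
  have hpq : f.hom ≫ q = p ≫ (kernelFunctor E).map f := by
    rw [← cancel_mono (kernelFunctorι Q), Category.assoc, Category.assoc, hq, kernelFunctor_map_ι,
      ← Category.assoc, hp, Category.id_comp, Category.comp_id]
  have : Mono p := ⟨fun a b hab => by
    rw [← Category.comp_id a, ← hp, ← Category.assoc, hab, Category.assoc, hp, Category.comp_id]⟩
  have : Mono f := ⟨fun a b hab => Pt.hom_ext <| by
    rw [← cancel_mono p, ← cancel_mono ((kernelFunctor E).map f), Category.assoc, Category.assoc,
      ← hpq, ← Category.assoc, ← Category.assoc]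
    exact congr(($hab).hom ≫ q)⟩
  let W : Pt E := ⟨Z, 0, 0, hE.eq_of_tgt _ _⟩
  let n : Q ⟶ W := ⟨q ≫ m, hE.eq_of_tgt _ _, hE.eq_of_src _ _⟩
  refine .mk n (Pt.hom_ext ?_) fun T t ht => ?_
  · change f.hom ≫ q ≫ m = P.proj ≫ 0
    rw [← Category.assoc, hpq, Category.assoc, hfm, comp_zero, comp_zero]
  · have ht' : (t.hom ≫ q) ≫ m = 0 := by
      rw [Category.assoc]
      exact congr(($ht).hom).trans comp_zero
    obtain ⟨l, hl⟩ := exists_lift_of_isLimit hl _ ht'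
    refine ⟨⟨l ≫ kernelFunctorι P, hE.eq_of_tgt _ _, hE.eq_of_src _ _⟩, Pt.hom_ext ?_⟩
    change (l ≫ kernelFunctorι P) ≫ f.hom = t.hom
    rw [Category.assoc, ← kernelFunctor_map_ι, ← Category.assoc, hl, Category.assoc, hq,
      Category.comp_id]

end OverZero

/-! ### Semi-abelian categories and the equivalence -/

section SemiAbelian

variable {C : Type u} [Category.{v} C] [HasZeroMorphisms C] [SemiAbelian C] {A : C}

instance SemiAbelian.instHasFiniteCoproducts : HasFiniteCoproducts C :=
  SemiAbelian.hasFiniteCoproducts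

instance SemiAbelian.kernelFunctor_reflectsIsomorphisms :
    (kernelFunctor A).ReflectsIsomorphisms :=
  SemiAbelian.protomodular A

/-- The kernel and the section of a point are jointly epimorphic. -/
lemma Pt.jointly_epi (P : Pt A) {T : C} {a b : P.obj ⟶ T}
    (hk : kernelFunctorι P ≫ a = kernelFunctorι P ≫ b) (hs : P.sec ≫ a = P.sec ≫ b) : a = b := by
  -- The equalizer is a subpoint of `P` containing the whole kernel, so by protomodularity it is all
  -- of `P`.
  let E : Pt A := ⟨equalizer a b, equalizer.ι a b ≫ P.proj, equalizer.lift P.sec hs, by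
    rw [← Category.assoc, equalizer.lift_ι, P.sec_proj]⟩
  let f : E ⟶ P := ⟨equalizer.ι a b, rfl, equalizer.lift_ι _ _⟩
  have : Mono f.hom := inferInstanceAs (Mono (equalizer.ι a b))
  have := kernelFunctor_mono_map f
  have hE : equalizer.lift (kernelFunctorι P) hk ≫ f.hom = kernelFunctorι P := equalizer.lift_ι _ _
  obtain ⟨l, hl⟩ := exists_lift_kernelFunctorι E (equalizer.lift (kernelFunctorι P) hk) (by
    rw [← Pt.hom_proj f, ← Category.assoc, hE, kernelFunctorι_proj])
  have hlf : l ≫ (kernelFunctor A).map f = 𝟙 _ := by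
    rw [← cancel_mono (kernelFunctorι P), Category.assoc, kernelFunctor_map_ι, ← Category.assoc,
      hl, hE, Category.id_comp]
  have : IsIso ((kernelFunctor A).map f) :=
    ⟨l, by rw [← cancel_mono ((kernelFunctor A).map f), Category.assoc, hlf, Category.id_comp,
      Category.comp_id], hlf⟩
  have := isIso_of_reflects_iso f (kernelFunctor A)
  have := Pt.isIso_hom f
  exact (cancel_epi f.hom).1 (equalizer.condition a b)

/-- A regular epimorphism is a cokernel of its kernel. -/
lemma isCokernelOf_of_isRegularEpi {K X Y : C} (q : X ⟶ Y) [IsRegularEpi q] (k : K ⟶ X)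
    (hk : k ≫ q = 0) (hl : ∀ ⦃T : C⦄ (t : T ⟶ X), t ≫ q = 0 → ∃ l : T ⟶ K, l ≫ k = t) :
    IsCokernelOf q k := by
  refine .mk hk fun T t ht => ?_
  -- The kernel pair of `q` is a point over `X` with the diagonal as section. A map `t` killing the
  -- kernel of `q` equalizes the two projections on the kernel of this point and on the diagonal,
  -- hence everywhere.
  let R : Pt X := ⟨pullback q q, pullback.fst q q, pullback.lift (𝟙 X) (𝟙 X) rfl,
    pullback.lift_fst _ _ _⟩
  have h₁ : R.sec ≫ pullback.fst q q = 𝟙 X := pullback.lift_fst _ _ _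
  have h₂ : R.sec ≫ pullback.snd q q = 𝟙 X := pullback.lift_snd _ _ _
  have h₀ : kernelFunctorι R ≫ pullback.fst q q = 0 := kernelFunctorι_proj R
  obtain ⟨l, hl⟩ := hl (kernelFunctorι R ≫ pullback.snd q q) (by
    rw [Category.assoc, ← pullback.condition, ← Category.assoc, h₀, zero_comp])
  have e : pullback.fst q q ≫ t = pullback.snd q q ≫ t := by
    apply R.jointly_epi
    · rw [← Category.assoc, ← Category.assoc, h₀, ← hl, zero_comp, Category.assoc, ht, comp_zero]
    · rw [← Category.assoc, ← Category.assoc, h₁, h₂]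
  have hc := (IsKernelPair.of_hasPullback q).toCoequalizer'
  exact ⟨_, (Cofork.IsColimit.desc' hc t e).2⟩

lemma kernelFunctor_isRegularEpi_map {P Q : Pt A} (f : P ⟶ Q) [h : IsRegularEpi f.hom] :
    IsRegularEpi ((kernelFunctor A).map f) :=
  Regular.regularEpiIsStableUnderBaseChange.of_isPullback (isPullback_kernelFunctor_map f).flip h

/-- A normal monomorphism of points has a cokernel preserved by the kernel functor, which sends it
to a kernel map. -/
lemma IsNormalMono.exists_cokernel {P Q : Pt A} {f : P ⟶ Q} (hf : IsNormalMono f) :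
    ∃ (D : Pt A) (γ : Q ⟶ D), IsCokernelOf γ f ∧
      IsCokernelOf ((kernelFunctor A).map γ) ((kernelFunctor A).map f) ∧
      IsKernelMap ((kernelFunctor A).map f) := by
  obtain ⟨hmono, R, r₁, r₂, hR, S, p₁, p₂, h, ⟨hS⟩, hp₁, hp₂⟩ := hf
  -- The morphism `q'` need not be a regular epimorphism; it factors through the coequalizer `q`,
  -- which therefore has the same kernel pair.
  obtain ⟨Y, q', hq'⟩ := SemiAbelian.effective _ _ (Pt.isEquivalenceRelation_hom hR)
  have : HasCoequalizer r₁.hom r₂.hom := Regular.hasCoequalizer_of_isKernelPair hq'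
  obtain ⟨q, hqdef⟩ : ∃ q, q = coequalizer.π r₁.hom r₂.hom := ⟨_, rfl⟩
  have hqw : r₁.hom ≫ q = r₂.hom ≫ q := by rw [hqdef, coequalizer.condition]
  have hqr : IsRegularEpi q := by rw [hqdef]; infer_instance
  have hq : IsKernelPair q r₁.hom r₂.hom := by
    refine IsKernelPair.cancel_right (f₂ := coequalizer.desc q' hq'.w) hqw ?_
    rwa [hqdef, coequalizer.π_desc]
  have hQ : r₁.hom ≫ Q.proj = r₂.hom ≫ Q.proj := by rw [Pt.hom_proj, Pt.hom_proj]
  let D : Pt A := ⟨coequalizer r₁.hom r₂.hom, coequalizer.desc Q.proj hQ, Q.sec ≫ q, by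
    rw [Category.assoc, hqdef, coequalizer.π_desc, Q.sec_proj]⟩
  let γ : Q ⟶ D := ⟨q, by rw [hqdef]; exact coequalizer.π_desc _ _, rfl⟩
  have hγr : IsRegularEpi γ.hom := hqr
  have hfγ : f ≫ γ = 0 := by
    -- Here `d = (1, 0)`: every element of the class is related to zero.
    obtain ⟨d, hd₁, hd₂⟩ : ∃ d : P ⟶ S, d ≫ p₁ = 𝟙 P ∧ d ≫ p₂ = 0 :=
      ⟨_, (BinaryFan.IsLimit.lift' hS (𝟙 P) 0).2⟩
    have hr : r₁ ≫ γ = r₂ ≫ γ := Pt.hom_ext hqw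
    have e : d ≫ (p₁ ≫ f) ≫ γ = d ≫ (p₂ ≫ f) ≫ γ := by
      rw [← hp₁.w, ← hp₂.w, Category.assoc, Category.assoc, hr]
    rwa [Category.assoc, Category.assoc, ← Category.assoc d, ← Category.assoc d, hd₁, hd₂,
      Category.id_comp, zero_comp] at e
  have hfq : f.hom ≫ γ.hom = P.proj ≫ D.sec := congr(($hfγ).hom)
  have hker : ∀ ⦃T : C⦄ (t : T ⟶ Q.obj), t ≫ γ.hom = 0 →
      ∃ l : T ⟶ (kernelFunctor A).obj P, l ≫ kernelFunctorι P ≫ f.hom = t := by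
    intro T t ht
    -- The pair `(0, t)` lies in the relation and `0` lies in the class, so the discrete fibration
    -- property puts `t` in the class.
    have w : (0 : T ⟶ Q.obj) ≫ q = t ≫ q := by rw [zero_comp]; exact ht.symm
    have hp := Pt.isPullback_hom hp₁
    have w' : hq.lift 0 t w ≫ r₁.hom = 0 ≫ f.hom := by rw [IsKernelPair.lift_fst, zero_comp]
    have e : (hp.lift _ _ w' ≫ p₂.hom) ≫ f.hom = t := by
      have h₂ : h.hom ≫ r₂.hom = p₂.hom ≫ f.hom := congr(($hp₂.w).hom)
      rw [Category.assoc, ← h₂, ← Category.assoc, hp.lift_fst, IsKernelPair.lift_snd]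
    obtain ⟨l, hl⟩ := exists_lift_kernelFunctorι P (hp.lift _ _ w' ≫ p₂.hom) (by
      rw [← Pt.hom_proj f, ← Category.assoc, e, ← Pt.hom_proj γ, ← Category.assoc, ht, zero_comp])
    exact ⟨l, by rw [← Category.assoc, hl, e]⟩
  -- In `C` the kernel of `γ.hom` is the kernel of `P`, embedded by `f`, and not `P.obj` itself: `γ`
  -- sends `f` to the zero map of points, which factors through `A`.
  have hcok : IsCokernelOf γ.hom (kernelFunctorι P ≫ f.hom) :=
    isCokernelOf_of_isRegularEpi _ _
      (by rw [Category.assoc, hfq, ← Category.assoc, kernelFunctorι_proj, zero_comp]) hker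
  have hepi := hcok.epi
  have : Epi γ := ⟨fun a b hab => Pt.hom_ext ((cancel_epi γ.hom).1 congr(($hab).hom))⟩
  have hK : (kernelFunctor A).map f ≫ (kernelFunctor A).map γ = 0 := by
    rw [← Functor.map_comp, kernelFunctor_map_eq_zero _ hfγ]
  have hKl : ∀ ⦃T : C⦄ (t : T ⟶ (kernelFunctor A).obj Q), t ≫ (kernelFunctor A).map γ = 0 →
      ∃ l : T ⟶ (kernelFunctor A).obj P, l ≫ (kernelFunctor A).map f = t := by
    intro T t ht
    obtain ⟨l, hl⟩ := hker (t ≫ kernelFunctorι Q) (by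
      rw [Category.assoc, ← kernelFunctor_map_ι, ← Category.assoc, ht, zero_comp])
    exact ⟨l, by rw [← cancel_mono (kernelFunctorι Q), Category.assoc, kernelFunctor_map_ι, hl]⟩
  refine ⟨D, γ, .mk hfγ fun T t ht => ?_, ?_, ?_⟩
  · have hft : f.hom ≫ t.hom = P.proj ≫ T.sec := congr(($ht).hom)
    obtain ⟨l, hl⟩ := hcok.exists_desc t.hom (by
      rw [Category.assoc, hft, ← Category.assoc, kernelFunctorι_proj, zero_comp])
    refine ⟨⟨l, ?_, ?_⟩, Pt.hom_ext hl⟩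
    · rw [← cancel_epi γ.hom, ← Category.assoc, hl, Pt.hom_proj, Pt.hom_proj]
    · rw [← Pt.sec_hom γ, Category.assoc, hl, Pt.sec_hom]
  · have := kernelFunctor_isRegularEpi_map γ
    exact isCokernelOf_of_isRegularEpi _ _ hK hKl
  · have := Pt.mono_hom f
    have := kernelFunctor_mono_map f
    exact .mk _ hK hKl

/-- A morphism of points whose restriction to the kernels is a kernel map with a cokernel that
lifts to a morphism of points vanishing on it, is itself a kernel map. -/
lemma isKernelMap_of_isCokernelOf_map {P Q D : Pt A} {f : P ⟶ Q} {γ : Q ⟶ D} (hγ : f ≫ γ = 0)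
    (hf : IsKernelMap ((kernelFunctor A).map f))
    (hK : IsCokernelOf ((kernelFunctor A).map γ) ((kernelFunctor A).map f)) :
    IsKernelMap f := by
  have := hf.mono
  have := Pt.mono_hom (kernel.ι γ)
  have := kernelFunctor_mono_map (kernel.ι γ)
  have hc : kernel.lift γ f hγ ≫ kernel.ι γ = f := kernel.lift_ι _ _ _
  have hKc : (kernelFunctor A).map (kernel.lift γ f hγ) ≫ (kernelFunctor A).map (kernel.ι γ) =
      (kernelFunctor A).map f := by rw [← Functor.map_comp, hc]
  -- Since `K_A(f)` is a kernel of its cokernel `K_A(γ)`, the image under `K_A` of the inclusion of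
  -- the kernel of `γ` factors through it; `d` inverts the comparison on kernels.
  obtain ⟨d, hd⟩ := hf.exists_lift_of_isCokernelOf hK ((kernelFunctor A).map (kernel.ι γ)) (by
    rw [← Functor.map_comp, kernelFunctor_map_eq_zero _ (kernel.condition γ)])
  have : IsIso ((kernelFunctor A).map (kernel.lift γ f hγ)) :=
    ⟨d, by rw [← cancel_mono ((kernelFunctor A).map f), Category.assoc, hd, hKc, Category.id_comp],
      by rw [← cancel_mono ((kernelFunctor A).map (kernel.ι γ)), Category.assoc, hKc, hd,
        Category.id_comp]⟩
  have := isIso_of_reflects_iso (kernel.lift γ f hγ) (kernelFunctor A)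
  exact (isKernelMap_kernel_ι γ).of_iso (asIso (kernel.lift γ f hγ)).symm (Iso.refl _) (by simp)

lemma changeOfBase_reflectsIsomorphisms {E A : C} (g : E ⟶ A) :
    (changeOfBase g).ReflectsIsomorphisms where
  reflects {P Q} f _ := by
    obtain ⟨i, j, h⟩ := exists_iso_kernelFunctor_changeOfBase g f
    have : IsIso ((kernelFunctor A).map f) := by
      rw [← Iso.inv_comp_eq] at h
      rw [← h]
      infer_instance
    exact isIso_of_reflects_iso f (kernelFunctor A)

/-- Only the reflection of normal monomorphisms along `0 ⟶ A` is needed. -/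
lemma IsStronglySemiAbelian.conditionCStar (h : IsStronglySemiAbelian C) (A : C) :
    ConditionCStar A := by
  intro P Q f hf
  obtain ⟨O, hO⟩ := (SemiAbelian.hasZeroObject : HasZeroObject C)
  have hker : IsKernelMap ((changeOfBase (0 : O ⟶ A)).map f) :=
    isKernelMap_of_kernelFunctor_map hO _ ((isKernelMap_kernelFunctor_changeOfBase_iff _ f).2 hf)
  obtain ⟨D, γ, hγ, hKγ, _⟩ :=
    ((h.stronglyProtomodular (0 : O ⟶ A)).reflects_normalMono f hker.isNormalMono).exists_cokernel
  exact ⟨D, γ, ⟨hγ, hKγ⟩, fun D' γ' h' => hγ.existsUnique_iso h'.1⟩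

lemma isStronglySemiAbelian_of_conditionCStar (h : ∀ A : C, ConditionCStar A) :
    IsStronglySemiAbelian C where
  toSemiAbelian := inferInstance
  stronglyProtomodular {_ A} g :=
    { leftExact := changeOfBase_preservesFiniteLimits g
      conservative := changeOfBase_reflectsIsomorphisms g
      reflects_normalMono := fun {P Q} f hf => by
        obtain ⟨_, _, _, _, hker⟩ := hf.exists_cokernel
        have hker := (isKernelMap_kernelFunctor_changeOfBase_iff g f).1 hker
        obtain ⟨D, γ, ⟨hγ, hKγ⟩, _⟩ := h A f hker
        exact (isKernelMap_of_isCokernelOf_map hγ.1 hker hKγ).isNormalMono }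

end SemiAbelian

end StronglySemiAbelian

theorem proposition3p7 {C : Type u} [Category.{v} C] [HasZeroMorphisms C]
    [StronglySemiAbelian.SemiAbelian C] :
    StronglySemiAbelian.IsStronglySemiAbelian C ↔
      ∀ A : C, StronglySemiAbelian.ConditionCStar A :=
  ⟨StronglySemiAbelian.IsStronglySemiAbelian.conditionCStar,
    StronglySemiAbelian.isStronglySemiAbelian_of_conditionCStar⟩
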